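/- Let $M$ be a smooth $n$-dimensional manifold, let $0<T\le\infty$, and let $g_t$, $t\in[0,T)$, be Riemannian metrics on $M$ depending smoothly on $(x,t)\in M\times[0,T)$. Assume that for each $t\in[0,T)$ the metric $g=g_t$ satisfies the (Hessian form of the) Omori–Yau maximum principle at infinity: for every $f\in C^2(M)$ that is bounded above there is a sequence $(x_k)_{k\ge1}$ in $M$ with $$f(x_k)>\sup_M f-\tfrac1k,\qquad |\nabla f|_{g}(x_k)<\tfrac1k,\qquad \nabla\nabla f(x_k)<\tfrac1k\,g .$$ Let $u:M\times[0,T)\to\mathbb R$ be smooth, let $C:(0,T)\to\mathbb R$ be a function and $\alpha\in(0,1]$, and assume that for every $t\in(0,T)$ and all $x\in M$, $s,s'\in(0,t]$, $$|u(x,t)|\le C(t),\quad |\nabla^{g_t}u(x,t)|_{g_t}\le C(t),\quad |u_t(x,s)|\le C(t),\quad |u_t(x,s)-u_t(x,s')|\le C(t)\,|s-s'|^\alpha .$$ Assume that on $M\times(0,T)$ $$\left(\partial_t-H^{ij}\nabla^{g_t}_i\nabla^{g_t}_j\right)u=\left\langle X(x,u,\nabla^{g_t}u,t),\nabla^{g_t}u\right\rangle_{g_t}+F(u),$$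 where $F:\mathbb R\to\mathbb R$ is locally Lipschitz; $H_{ij}(x,t)$ is a symmetric positive definite $2$-tensor on $T_xM$ (indices raised with $g_t$) with $|H|_{g_t}\le C_0$ for a constant $C_0$; and $X(x,r,v,t)\in T_xM$ (for $r\in\mathbb R$, $v\in T_xM$) satisfies $|X(x,u,\nabla^{g_t}u,t)|_{g_t}\le C_1(t)$ for all $x\in M$, $t\in(0,T)$, with some function $C_1$ of $t$. Put $u_{\sup}(t)=\sup_{x\in M}u(x,t)$. Then: 1. $u_{\sup}(t)$ is finite for each $t\in[0,T)$, and $u_{\sup}$ is locally Lipschitz on $[0,T)$ and hence differentiable at almost every $t\in[0,T)$. 2. At every $t\in(0,T)$ at which $u_{\sup}$ is differentiable, $$\frac{d u_{\sup}}{dt}(t)=\lim_{k\to\infty}\frac{\partial u}{\partial t}(x_k,t)$$ for every sequence $(x_k)$ in $M$ with $\lim_{k\to\infty}u(x_k,t)=u_{\sup}(t)$. 3. If $0<T'\le\infty$ and $\varphi:[0,T')\to\mathbb R$ solves $\varphi'(t)=F(\varphi(t))$ on $[0,T')$, $\varphi(0)=u_{\sup}(0)$ (in particular if $\varphi$ is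 the maximal solution), then $u(x,t)\le\varphi(t)$ for all $(x,t)\in M\times[0,\min\{T,T'\})$. -/

import Mathlib

open Set Filter Topology MeasureTheory Bundle
open scoped Manifold ContDiff

noncomputable section

/-- Smooth Riemannian metrics on the `n`-dimensional manifold `M`. -/
abbrev SmoothMetric (n : ℕ) (M : Type*) [TopologicalSpace M]
    [ChartedSpace (EuclideanSpace ℝ (Fin n)) M] [IsManifold (𝓡 n) ∞ M] :=
  ContMDiffRiemannianMetric (𝓡 n) ∞ (EuclideanSpace ℝ (Fin n))
    (fun x : M => TangentSpace (𝓡 n) x)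

/-- The half-open time interval `[0, T)`, where `T = ∞` is allowed. -/
def timeIco (T : EReal) : Set ℝ := {t | 0 ≤ t ∧ (t : EReal) < T}

/-- The open time interval `(0, T)`, where `T = ∞` is allowed. -/
def timeIoo (T : EReal) : Set ℝ := {t | 0 < t ∧ (t : EReal) < T}

namespace RiemCoord

variable {n : ℕ} {M : Type*} [TopologicalSpace M]
  [ChartedSpace (EuclideanSpace ℝ (Fin n)) M]

/-- The standard basis vector `e_i` of `ℝⁿ`. -/
def stdVec (i : Fin n) : EuclideanSpace ℝ (Fin n) := EuclideanSpace.single i (1 : ℝ)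

/-- The coordinate vector field `∂_i` of the chart around `x`, at the point of `M` with
coordinates `y`. -/
def coordField (x : M) (i : Fin n) (y : EuclideanSpace ℝ (Fin n)) :
    TangentSpace (𝓡 n) ((extChartAt (𝓡 n) x).symm y) :=
  mfderiv 𝓘(ℝ, EuclideanSpace ℝ (Fin n)) (𝓡 n) (extChartAt (𝓡 n) x).symm y (stdVec i)

/-- The coordinate tangent vector `∂_i` at `x` of the chart around `x`. -/
def frame (x : M) (i : Fin n) : TangentSpace (𝓡 n) x :=
  mfderiv 𝓘(ℝ, EuclideanSpace ℝ (Fin n)) (𝓡 n) (extChartAt (𝓡 n) x).symm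
    (extChartAt (𝓡 n) x x) (stdVec i)

/-- The components `A_{ij} = A(∂_i, ∂_j)` at `x` of a bilinear form on `T_x M`. -/
def comp (x : M)
    (A : TangentSpace (𝓡 n) x →L[ℝ] TangentSpace (𝓡 n) x →L[ℝ] ℝ) :
    Matrix (Fin n) (Fin n) ℝ :=
  Matrix.of fun i j => A (frame x i) (frame x j)

/-- The coordinate expression of a function `f` in the chart around `x`. -/
def coordFun (f : M → ℝ) (x : M) (y : EuclideanSpace ℝ (Fin n)) : ℝ :=
  f ((extChartAt (𝓡 n) x).symm y)

/-- The first partial derivative `∂_i f` in the chart around `x`, at the coordinates `y`. -/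
def partialD (f : M → ℝ) (x : M) (i : Fin n) (y : EuclideanSpace ℝ (Fin n)) : ℝ :=
  fderiv ℝ (coordFun f x) y (stdVec i)

/-- The second partial derivative `∂_i ∂_j f` at `x` in the chart around `x`. -/
def partialD2 (f : M → ℝ) (x : M) (i j : Fin n) : ℝ :=
  fderiv ℝ (partialD f x j) (extChartAt (𝓡 n) x x) (stdVec i)

variable [IsManifold (𝓡 n) ∞ M]

/-- The metric coefficients `g_{ij}` in the chart around `x`, at the coordinates `y`. -/
def metricCoeff (g : SmoothMetric n M) (x : M) (i j : Fin n)
    (y : EuclideanSpace ℝ (Fin n)) : ℝ :=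
  g.inner ((extChartAt (𝓡 n) x).symm y) (coordField x i y) (coordField x j y)

/-- The matrix `(g_{ij})` at `x`. -/
def metricMat (g : SmoothMetric n M) (x : M) : Matrix (Fin n) (Fin n) ℝ :=
  comp x (g.inner x)

/-- The inverse matrix `(g^{ij})` at `x`. -/
def invMetric (g : SmoothMetric n M) (x : M) : Matrix (Fin n) (Fin n) ℝ :=
  (metricMat g x)⁻¹

/-- The derivative `∂_k g_{ij}` at `x`. -/
def dMetric (g : SmoothMetric n M) (x : M) (k i j : Fin n) : ℝ :=
  fderiv ℝ (metricCoeff g x i j) (extChartAt (𝓡 n) x x) (stdVec k)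

/-- The Christoffel symbols `Γ^k_{ij}` of the Levi-Civita connection at `x`. -/
def christoffel (g : SmoothMetric n M) (x : M) (k i j : Fin n) : ℝ :=
  (1 / 2) * ∑ l, invMetric g x k l * (dMetric g x i j l + dMetric g x j i l - dMetric g x l i j)

/-- The components `∇_i ∇_j f = ∂_i ∂_j f - Γ^k_{ij} ∂_k f` at `x` of the Hessian of `f`. -/
def hess (g : SmoothMetric n M) (f : M → ℝ) (x : M) : Matrix (Fin n) (Fin n) ℝ :=
  Matrix.of fun i j => partialD2 f x i j
    - ∑ k, christoffel g x k i j * partialD f x k (extChartAt (𝓡 n) x x)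

/-- The gradient `∇f = g^{ij} ∂_j f ∂_i` at `x`. -/
def grad (g : SmoothMetric n M) (f : M → ℝ) (x : M) : TangentSpace (𝓡 n) x :=
  ∑ i, (∑ j, invMetric g x i j * partialD f x j (extChartAt (𝓡 n) x x)) • frame x i

/-- The length `|v|_g` of a tangent vector. -/
def vecNorm (g : SmoothMetric n M) (x : M) (v : TangentSpace (𝓡 n) x) : ℝ :=
  Real.sqrt (g.inner x v v)

/-- The contraction `A^{ij} B_{ij} = g^{ik} g^{jl} A_{kl} B_{ij}` at `x`, for the components
`A_{ij}`, `B_{ij}` of two covariant 2-tensors. -/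
def contract (g : SmoothMetric n M) (x : M) (A B : Matrix (Fin n) (Fin n) ℝ) : ℝ :=
  ∑ i, ∑ j, ∑ k, ∑ l, invMetric g x i k * invMetric g x j l * A k l * B i j

/-- The norm `|A|_g = (A^{ij} A_{ij})^{1/2}` at `x` of a covariant 2-tensor. -/
def tensorNorm (g : SmoothMetric n M) (x : M) (A : Matrix (Fin n) (Fin n) ℝ) : ℝ :=
  Real.sqrt (contract g x A A)

/-- The Omori-Yau maximum principle at infinity (in its Hessian form) holds for `(M, g)`: for every
`C²` function `f` bounded above there is a sequence of points `x_k` with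
`f(x_k) > sup f - 1/k`, `|∇f|(x_k) < 1/k` and `∇∇f(x_k) < (1/k) g` as quadratic forms
(`k ≥ 1` is written `k + 1` with `k : ℕ`). -/
def OmoriYau (g : SmoothMetric n M) : Prop :=
  ∀ f : M → ℝ, ContMDiff (𝓡 n) 𝓘(ℝ, ℝ) 2 f → BddAbove (range f) →
    ∃ x : ℕ → M, ∀ k : ℕ,
      f (x k) > (⨆ y, f y) - 1 / ((k : ℝ) + 1) ∧
      vecNorm g (x k) (grad g f (x k)) < 1 / ((k : ℝ) + 1) ∧
      ∀ v : Fin n → ℝ, v ≠ 0 →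
        ∑ i, ∑ j, hess g f (x k) i j * v i * v j
          < 1 / ((k : ℝ) + 1) * ∑ i, ∑ j, metricMat g (x k) i j * v i * v j

/-- The family of metrics `g t` depends smoothly on `(x, t)` for `t ∈ [0, T)`. -/
def SmoothFamily (T : EReal) (g : ℝ → SmoothMetric n M) : Prop :=
  ContMDiffOn ((𝓡 n).prod 𝓘(ℝ, ℝ))
    ((𝓡 n).prod 𝓘(ℝ, EuclideanSpace ℝ (Fin n) →L[ℝ] EuclideanSpace ℝ (Fin n) →L[ℝ] ℝ)) ∞
    (fun p : M × ℝ => TotalSpace.mk'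
      (EuclideanSpace ℝ (Fin n) →L[ℝ] EuclideanSpace ℝ (Fin n) →L[ℝ] ℝ)
      (E := fun x : M => TangentSpace (𝓡 n) x →L[ℝ] TangentSpace (𝓡 n) x →L[ℝ] ℝ)
      p.1 ((g p.2).inner p.1))
    (univ ×ˢ timeIco T)

/-- The spatial supremum `u_sup(t) = sup_x u(x, t)`. -/
def supSpace (u : M → ℝ → ℝ) (t : ℝ) : ℝ := ⨆ x, u x t

end RiemCoord

end

/-! ### Linear algebra: traces and contractions of semidefinite matrices. -/

section MatrixTrace

variable {ι : Type*} [Fintype ι]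

/-! Write S for the spatial supremum. Where a point nearly maximizes `u(·, t)`, Omori–Yau makes the
gradient at most 1/k and the Hessian at most g/k. Since H ≥ 0, the equation then gives u_t ≤ F(u) +
O(1/k) there (`OmoriYau.exists_seq_elliptic_le`).

The Hölder bound on u_t gives a first-order expansion in time, uniform in x
(`abs_sub_sub_mul_deriv_le`). Expanding backwards from t along the Omori–Yau points, using u(x_k, s)
≤ S(s) and letting k → ∞, yields S(t) - S(s) ≤ (t - s)(F(S(t)) + C(t - s)^α). Grönwall applied to
the positive part of S - φ then gives the comparison (`le_of_increment_le_ode`), without using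
differentiability of S.

The uniform bound on u_t makes S Lipschitz on compact time intervals. Where S is differentiable, the
same expansion squeezes u_t(x_k, t) between backward and forward quotients of S
(`tendsto_deriv_of_tendsto_iSup`). -/

open scoped MatrixOrder in
theorem Matrix.PosSemidef.exists_eq_transpose_mul_self [DecidableEq ι] {P : Matrix ι ι ℝ}
    (hP : P.PosSemidef) : ∃ R : Matrix ι ι ℝ, P = R.transpose * R := by
  obtain ⟨R, hR⟩ := CStarAlgebra.nonneg_iff_eq_star_mul_self.mp hP.nonneg
  exact ⟨R, by rw [hR, Matrix.star_eq_conjTranspose, Matrix.conjTranspose_eq_transpose_of_trivial]⟩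

theorem Matrix.sum_mul_eq_trace_mul_transpose (A B : Matrix ι ι ℝ) :
    ∑ i, ∑ j, A i j * B i j = (A * B.transpose).trace := by
  simp [Matrix.trace, Matrix.mul_apply]

/-- Factoring Q = RᵀR turns the contraction into a sum of values of the quadratic form S on the rows
of R; S need not be symmetric. -/
theorem Matrix.PosSemidef.sum_mul_nonneg [DecidableEq ι] {Q S : Matrix ι ι ℝ}
    (hQ : Q.PosSemidef) (hS : ∀ v : ι → ℝ, 0 ≤ ∑ i, ∑ j, S i j * v i * v j) :
    0 ≤ ∑ i, ∑ j, Q i j * S i j := by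
  obtain ⟨R, rfl⟩ := hQ.exists_eq_transpose_mul_self
  have key : ∑ i, ∑ j, (R.transpose * R) i j * S i j
      = ∑ m, ∑ i, ∑ j, S i j * R m i * R m j := by
    rw [Finset.sum_comm (f := fun m i => ∑ j, S i j * R m i * R m j)]
    refine Finset.sum_congr rfl fun i _ => ?_
    rw [Finset.sum_comm]
    refine Finset.sum_congr rfl fun j _ => ?_
    rw [Matrix.mul_apply, Finset.sum_mul]
    exact Finset.sum_congr rfl fun m _ => by rw [Matrix.transpose_apply]; ring
  rw [key]
  exact Finset.sum_nonneg fun m _ => hS (R m)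

theorem Matrix.sq_trace_le (A : Matrix ι ι ℝ) :
    A.trace ^ 2 ≤ Fintype.card ι * ∑ i, ∑ j, A i j * A i j := by
  refine (sq_sum_le_card_mul_sum_sq (s := Finset.univ) (f := fun i => A i i)).trans ?_
  rw [Finset.card_univ]
  refine mul_le_mul_of_nonneg_left (Finset.sum_le_sum fun i _ => ?_) (Nat.cast_nonneg _)
  rw [sq]
  exact Finset.single_le_sum (f := fun j => A i j * A i j)
    (fun j _ => mul_self_nonneg _) (Finset.mem_univ i)

/-- Cauchy–Schwarz for the trace of `A` with respect to the inner product with dual matrix `P`. -/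
theorem Matrix.PosSemidef.sq_trace_mul_le [DecidableEq ι] {P : Matrix ι ι ℝ} (hP : P.PosSemidef)
    (A : Matrix ι ι ℝ) :
    (P * A).trace ^ 2 ≤ Fintype.card ι * ∑ i, ∑ j, (P * A * P.transpose) i j * A i j := by
  obtain ⟨R, rfl⟩ := hP.exists_eq_transpose_mul_self
  -- By cyclicity of the trace, both sides depend only on R A Rᵀ: its trace and its squared
  -- Hilbert–Schmidt norm.
  have h1 : (R.transpose * R * A).trace = (R * A * R.transpose).trace := by
    rw [Matrix.mul_assoc, Matrix.trace_mul_comm, Matrix.mul_assoc]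
  have h2 : ∑ i, ∑ j, (R.transpose * R * A * (R.transpose * R).transpose) i j * A i j
      = ∑ i, ∑ j, (R * A * R.transpose) i j * (R * A * R.transpose) i j := by
    rw [Matrix.sum_mul_eq_trace_mul_transpose, Matrix.sum_mul_eq_trace_mul_transpose]
    simp only [Matrix.transpose_mul, Matrix.transpose_transpose, Matrix.mul_assoc]
    rw [Matrix.trace_mul_comm]
    simp only [Matrix.mul_assoc]
  rw [h1, h2]
  exact Matrix.sq_trace_le _

theorem Matrix.PosSemidef.of_sum_nonneg {A : Matrix ι ι ℝ} (hsymm : ∀ i j, A i j = A j i)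
    (h : ∀ v : ι → ℝ, 0 ≤ ∑ i, ∑ j, A i j * v i * v j) : A.PosSemidef := by
  refine .of_dotProduct_mulVec_nonneg (Matrix.IsHermitian.ext fun i j => by simp [hsymm i j])
    fun v => (h v).trans_eq ?_
  simp only [dotProduct, Matrix.mulVec, star_trivial, Finset.mul_sum]
  exact Finset.sum_congr rfl fun i _ => Finset.sum_congr rfl fun j _ => by ring

end MatrixTrace

/-! ### Metric contractions and Cauchy–Schwarz on the tangent space. -/

namespace RiemCoord

variable {n : ℕ} {M : Type*} [TopologicalSpace M]
  [ChartedSpace (EuclideanSpace ℝ (Fin n)) M]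

/-- The matrix evaluates A on the combinations Σ vᵢ ∂ᵢ. Semidefiniteness suffices later and spares
proving that the frame is linearly independent. -/
theorem comp_posSemidef (x : M)
    (A : TangentSpace (𝓡 n) x →L[ℝ] TangentSpace (𝓡 n) x →L[ℝ] ℝ)
    (hsymm : ∀ v w, A v w = A w v) (hpos : ∀ v, v ≠ 0 → 0 < A v v) :
    (comp x A).PosSemidef := by
  refine .of_sum_nonneg (fun i j => hsymm _ _) fun v => ?_
  have h : ∑ i, ∑ j, comp x A i j * v i * v j
      = A (∑ i, v i • frame x i) (∑ j, v j • frame x j) := by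
    rw [map_sum (A (∑ i, v i • frame x i)), Finset.sum_comm]
    refine Finset.sum_congr rfl fun j _ => ?_
    rw [map_smul, map_sum, sum_apply, smul_eq_mul, Finset.mul_sum]
    refine Finset.sum_congr rfl fun i _ => ?_
    rw [map_smul, smul_apply, smul_eq_mul, comp, Matrix.of_apply]
    ring
  rw [h]
  rcases eq_or_ne (∑ i, v i • frame x i) 0 with h0 | h0
  · rw [h0, map_zero]
  · exact (hpos _ h0).le

variable [IsManifold (𝓡 n) ∞ M]

theorem metricMat_posSemidef (g : SmoothMetric n M) (x : M) : (metricMat g x).PosSemidef :=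
  comp_posSemidef x (g.inner x) (g.symm x) (g.pos x)

theorem invMetric_posSemidef (g : SmoothMetric n M) (x : M) : (invMetric g x).PosSemidef :=
  (metricMat_posSemidef g x).inv

/-- The relation `G⁻¹ G G⁻¹ = G⁻¹`; it does not rely on the coordinate frame being a basis. -/
theorem invMetric_mul_metricMat_mul_invMetric (g : SmoothMetric n M) (x : M) :
    invMetric g x * metricMat g x * invMetric g x = invMetric g x := by
  rw [invMetric]
  by_cases h : IsUnit (metricMat g x).det
  · rw [Matrix.nonsing_inv_mul _ h, Matrix.one_mul]
  -- A singular matrix has inverse 0 by convention, so the identity is trivial.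
  · rw [Matrix.nonsing_inv_apply_not_isUnit _ h, Matrix.mul_zero]

theorem contract_eq_sum (g : SmoothMetric n M) (x : M) (A B : Matrix (Fin n) (Fin n) ℝ) :
    contract g x A B
      = ∑ i, ∑ j, (invMetric g x * A * (invMetric g x).transpose) i j * B i j := by
  refine Finset.sum_congr rfl fun i _ => Finset.sum_congr rfl fun j _ => ?_
  simp only [Matrix.mul_apply, Matrix.transpose_apply, Finset.sum_mul]
  rw [Finset.sum_comm]
  exact Finset.sum_congr rfl fun l _ => Finset.sum_congr rfl fun k _ => by ring

/-- Cauchy–Schwarz for the pairing of A with g; √n accounts for the norm of g. -/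
theorem trace_invMetric_mul_le (g : SmoothMetric n M) (x : M) (A : Matrix (Fin n) (Fin n) ℝ) :
    (invMetric g x * A).trace ≤ √n * tensorNorm g x A := by
  have h := (invMetric_posSemidef g x).sq_trace_mul_le A
  rw [Fintype.card_fin, ← contract_eq_sum] at h
  rw [tensorNorm, ← Real.sqrt_mul (Nat.cast_nonneg n)]
  exact Real.le_sqrt_of_sq_le h

theorem contract_metricMat (g : SmoothMetric n M) (x : M) (A : Matrix (Fin n) (Fin n) ℝ) :
    contract g x A (metricMat g x) = (invMetric g x * A).trace := by
  have hP : (invMetric g x).transpose = invMetric g x := by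
    simpa using (invMetric_posSemidef g x).isHermitian.eq
  have hG : (metricMat g x).transpose = metricMat g x := by
    simpa using (metricMat_posSemidef g x).isHermitian.eq
  rw [contract_eq_sum, Matrix.sum_mul_eq_trace_mul_transpose, hP, hG, Matrix.mul_assoc,
    Matrix.trace_mul_comm, ← Matrix.mul_assoc, invMetric_mul_metricMat_mul_invMetric]

/-- If `B ≤ ε g` as quadratic forms and `A ≥ 0`, then `A^{ij} B_{ij} ≤ ε √n |A|_g`. -/
theorem contract_le_of_quadForm_le (g : SmoothMetric n M) (x : M)
    {A B : Matrix (Fin n) (Fin n) ℝ} {ε : ℝ} (hε : 0 ≤ ε) (hA : A.PosSemidef)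
    (hB : ∀ v : Fin n → ℝ, ∑ i, ∑ j, B i j * v i * v j
      ≤ ε * ∑ i, ∑ j, metricMat g x i j * v i * v j) :
    contract g x A B ≤ ε * (√n * tensorNorm g x A) := by
  have hQ : (invMetric g x * A * (invMetric g x).transpose).PosSemidef := by
    simpa using hA.mul_mul_conjTranspose_same (invMetric g x)
  -- A with raised indices is still semidefinite, so it pairs nonnegatively with εg - B.
  have h := hQ.sum_mul_nonneg (S := ε • metricMat g x - B) fun v => by
    simpa [sub_mul, Finset.sum_sub_distrib, Finset.mul_sum, mul_assoc] using hB v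
  have h' : contract g x A B ≤ ε * contract g x A (metricMat g x) := by
    rw [contract_eq_sum, contract_eq_sum, ← sub_nonneg]
    refine h.trans_eq ?_
    simp only [Finset.mul_sum, ← Finset.sum_sub_distrib, Matrix.sub_apply, Matrix.smul_apply,
      smul_eq_mul]
    exact Finset.sum_congr rfl fun i _ => Finset.sum_congr rfl fun j _ => by ring
  refine h'.trans (mul_le_mul_of_nonneg_left ?_ hε)
  rw [contract_metricMat]
  exact trace_invMetric_mul_le g x A

/-- The quadratic s ↦ |v + s w|² is nonnegative, so its discriminant is nonpositive. -/
theorem inner_le_vecNorm_mul_vecNorm (g : SmoothMetric n M) (x : M)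
    (v w : TangentSpace (𝓡 n) x) : g.inner x v w ≤ vecNorm g x v * vecNorm g x w := by
  have hnn : ∀ z : TangentSpace (𝓡 n) x, 0 ≤ g.inner x z z := fun z => by
    rcases eq_or_ne z 0 with rfl | hz
    · rw [map_zero]
    · exact (g.pos x z hz).le
  have hd := discrim_le_zero (a := g.inner x w w) (b := 2 * g.inner x v w)
    (c := g.inner x v v) fun s => by
      have := hnn (v + s • w)
      simp only [map_add, map_smul, add_apply,
        smul_apply, smul_eq_mul, g.symm x w v] at this
      linarith
  rw [discrim] at hd
  rw [vecNorm, vecNorm, ← Real.sqrt_mul (hnn v)]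
  exact Real.le_sqrt_of_sq_le (by nlinarith)

end RiemCoord

/-! ### Mean value and Taylor estimates in time. -/

theorem abs_sub_le_of_abs_deriv_le {f : ℝ → ℝ} {a b K : ℝ} (hab : a ≤ b)
    (hc : ContinuousOn f (Icc a b)) (hd : ∀ r ∈ Ioo a b, DifferentiableAt ℝ f r)
    (hK : ∀ r ∈ Ioo a b, |deriv f r| ≤ K) : |f b - f a| ≤ K * (b - a) := by
  have hd' : DifferentiableOn ℝ f (interior (Icc a b)) := by
    rw [interior_Icc]
    exact fun r hr => (hd r hr).differentiableWithinAt
  rw [abs_le]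
  constructor
  · have := (convex_Icc a b).mul_sub_le_image_sub_of_le_deriv (C := -K) hc hd'
      (fun r hr => neg_le_of_abs_le (hK r (by rwa [interior_Icc] at hr)))
      a (left_mem_Icc.mpr hab) b (right_mem_Icc.mpr hab) hab
    linarith
  · exact (convex_Icc a b).image_sub_le_mul_sub_of_deriv_le hc hd'
      (fun r hr => le_of_abs_le (hK r (by rwa [interior_Icc] at hr)))
      a (left_mem_Icc.mpr hab) b (right_mem_Icc.mpr hab) hab

/-- First-order Taylor estimate for a function with Hölder continuous derivative. -/
theorem abs_sub_sub_mul_deriv_le {f : ℝ → ℝ} {b C α : ℝ} (hC : 0 ≤ C) (hα : 0 < α)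
    (hc : ContinuousOn f (Icc 0 b)) (hd : ∀ r ∈ Ioc 0 b, DifferentiableAt ℝ f r)
    (hH : ∀ r ∈ Ioc 0 b, ∀ r' ∈ Ioc 0 b, |deriv f r - deriv f r'| ≤ C * |r - r'| ^ α)
    {s s' : ℝ} (hs : s ∈ Ioc 0 b) (hs' : s' ∈ Icc 0 b) :
    |f s' - f s - (s' - s) * deriv f s| ≤ C * |s' - s| ^ α * |s' - s| := by
  -- With the tangent slope at s removed, the derivative is a Hölder difference, and the mean value
  -- inequality applies. It needs derivatives only strictly between s and s', so s' = 0 is allowed.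
  set h : ℝ → ℝ := fun r => f r - deriv f s * r with h_def
  have hh : ∀ r ∈ Ioc 0 b, HasDerivAt h (deriv f r - deriv f s) r := fun r hr => by
    have := (hd r hr).hasDerivAt.fun_sub ((hasDerivAt_id r).const_mul (deriv f s))
    rwa [mul_one] at this
  have hhc : ContinuousOn h (Icc 0 b) :=
    hc.sub (continuous_const.mul continuous_id).continuousOn
  have hbound : ∀ r ∈ Ioc 0 b, |r - s| ≤ |s' - s| →
      |deriv h r| ≤ C * |s' - s| ^ α := fun r hr hrs => by
    rw [(hh r hr).deriv]
    exact (hH r hr s hs).trans (mul_le_mul_of_nonneg_left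
      (Real.rpow_le_rpow (abs_nonneg _) hrs hα.le) hC)
  have e : f s' - f s - (s' - s) * deriv f s = h s' - h s := by
    simp only [h_def]; ring
  rw [e]
  rcases le_total s s' with hle | hle
  · have := abs_sub_le_of_abs_deriv_le (K := C * |s' - s| ^ α) hle
      (hhc.mono (Icc_subset_Icc hs.1.le hs'.2))
      (fun r hr => (hh r ⟨hs.1.trans hr.1, hr.2.le.trans hs'.2⟩).differentiableAt)
      (fun r hr => hbound r ⟨hs.1.trans hr.1, hr.2.le.trans hs'.2⟩ (by
        rw [abs_of_pos (sub_pos.mpr hr.1), abs_of_nonneg (sub_nonneg.mpr hle)]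
        linarith [hr.2]))
    rwa [abs_of_nonneg (sub_nonneg.mpr hle)] at this ⊢
  · have := abs_sub_le_of_abs_deriv_le (K := C * |s' - s| ^ α) hle
      (hhc.mono (Icc_subset_Icc hs'.1 hs.2))
      (fun r hr => (hh r ⟨hs'.1.trans_lt hr.1, hr.2.le.trans hs.2⟩).differentiableAt)
      (fun r hr => hbound r ⟨hs'.1.trans_lt hr.1, hr.2.le.trans hs.2⟩ (by
        rw [abs_sub_comm, abs_sub_comm s', abs_of_pos (sub_pos.mpr hr.2),
          abs_of_nonneg (sub_nonneg.mpr hle)]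
        linarith [hr.1]))
    rw [abs_sub_comm (h s'), abs_sub_comm s']
    rw [abs_sub_comm s'] at this
    rwa [abs_of_nonneg (sub_nonneg.mpr hle)] at this ⊢

theorem tendsto_mul_rpow_nhdsGT_zero {C α : ℝ} (hα : 0 < α) :
    Tendsto (fun h : ℝ => C * h ^ α) (𝓝[>] 0) (𝓝 0) := by
  have h := ((Real.continuousAt_rpow_const 0 α (Or.inr hα.le)).tendsto.const_mul C).mono_left
    (nhdsWithin_le_nhds (s := Ioi (0 : ℝ)))
  simpa [Real.zero_rpow hα.ne'] using h

/-! ### Suprema of families of functions, and ODE comparison. -/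

section FamilySup

variable {ι : Type*} {u : ι → ℝ → ℝ}

/-- A derivative of a supremum of functions is the limit of the derivatives along any maximizing
sequence, provided the functions have uniform first-order expansions. -/
theorem tendsto_deriv_of_tendsto_iSup {b C α t D : ℝ} (hα : 0 < α)
    (ht : t ∈ Ioo 0 b) (hbdd : ∀ s ∈ Icc 0 b, BddAbove (range fun x => u x s))
    (htaylor : ∀ x, ∀ s' ∈ Icc 0 b,
      |u x s' - u x t - (s' - t) * deriv (u x) t| ≤ C * |s' - t| ^ α * |s' - t|)
    (hD : HasDerivAt (fun s => ⨆ x, u x s) D t) (x : ℕ → ι)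
    (hx : Tendsto (fun k => u (x k) t) atTop (𝓝 (⨆ y, u y t))) :
    Tendsto (fun k => deriv (u (x k)) t) atTop (𝓝 D) := by
  set S : ℝ → ℝ := fun s => ⨆ y, u y s with hS
  have hslope : Tendsto (fun h : ℝ => h⁻¹ • (S (t + h) - S t)) (𝓝[≠] 0) (𝓝 D) :=
    hasDerivAt_iff_tendsto_slope_zero.mp hD
  have hright := hslope.mono_left (nhdsGT_le_nhdsNE (0 : ℝ))
  have hneg : Tendsto (fun h : ℝ => -h) (𝓝[>] 0) (𝓝[≠] 0) := by
    refine tendsto_nhdsWithin_iff.mpr ⟨?_, ?_⟩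
    · simpa using (continuous_neg.tendsto (0 : ℝ)).mono_left nhdsWithin_le_nhds
    · filter_upwards [self_mem_nhdsWithin] with h hh
      simpa using (ne_of_gt hh)
  have hleft := hslope.comp hneg
  have hsmall : ∀ᶠ h : ℝ in 𝓝[>] 0, h < min t (b - t) :=
    nhdsWithin_le_nhds (Iio_mem_nhds (lt_min ht.1 (sub_pos.mpr ht.2)))
  have hmax : ∀ δ > 0, ∀ᶠ k in atTop, S t - δ < u (x k) t := fun δ hδ =>
    hx.eventually (lt_mem_nhds (by linarith))
  rw [tendsto_order]
  constructor
  · intro a ha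
    -- One ε each for the difference quotient, the Hölder remainder and the defect from the
    -- supremum. The step h is fixed first, then k is taken large depending on h.
    set ε := (D - a) / 3 with hε
    have hε0 : 0 < ε := by rw [hε]; linarith
    obtain ⟨h, ⟨⟨h1, h2⟩, h3⟩, h0⟩ := (((hleft.eventually
      (lt_mem_nhds (show D - ε < D by linarith))).and ((tendsto_mul_rpow_nhdsGT_zero (C := C) hα).eventually (gt_mem_nhds hε0))).and
      hsmall |>.and self_mem_nhdsWithin).exists
    have h0 : 0 < h := h0
    have hmem : t - h ∈ Icc 0 b :=
      ⟨by linarith [h3.trans_le (min_le_left _ _)], by linarith [ht.2]⟩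
    filter_upwards [hmax (h * ε) (by positivity)] with k hk
    have e1 := htaylor (x k) (t - h) hmem
    have e2 : u (x k) (t - h) ≤ S (t - h) := le_ciSup (hbdd _ hmem) (x k)
    rw [sub_sub_cancel_left, abs_neg, abs_of_pos h0] at e1
    have e3 := (abs_le.mp e1).1
    have e4 : S (t - h) - S t < -(h * (D - ε)) := by
      have : D - ε < (-h)⁻¹ * (S (t + -h) - S t) := h1
      rw [← sub_eq_add_neg, inv_neg, neg_mul, ← mul_neg, inv_mul_eq_div, lt_div_iff₀ h0] at this
      linarith
    have e5 : C * h ^ α * h < ε * h := mul_lt_mul_of_pos_right h2 h0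
    have e6 : h * a = h * (D - 3 * ε) := by rw [hε]; ring
    have : h * a < h * deriv (u (x k)) t := by nlinarith
    exact lt_of_mul_lt_mul_left this h0.le
  · intro a ha
    set ε := (a - D) / 3 with hε
    have hε0 : 0 < ε := by rw [hε]; linarith
    obtain ⟨h, ⟨⟨h1, h2⟩, h3⟩, h0⟩ := (((hright.eventually
      (gt_mem_nhds (show D < D + ε by linarith))).and ((tendsto_mul_rpow_nhdsGT_zero (C := C) hα).eventually (gt_mem_nhds hε0))).and
      hsmall |>.and self_mem_nhdsWithin).exists
    have h0 : 0 < h := h0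
    have hmem : t + h ∈ Icc 0 b :=
      ⟨by linarith [ht.1], by linarith [h3.trans_le (min_le_right _ _)]⟩
    filter_upwards [hmax (h * ε) (by positivity)] with k hk
    have e1 := htaylor (x k) (t + h) hmem
    have e2 : u (x k) (t + h) ≤ S (t + h) := le_ciSup (hbdd _ hmem) (x k)
    rw [add_sub_cancel_left, abs_of_pos h0] at e1
    have e3 := (abs_le.mp e1).1
    have e4 : S (t + h) - S t < h * (D + ε) := by
      have : h⁻¹ * (S (t + h) - S t) < D + ε := h1
      rw [inv_mul_eq_div, div_lt_iff₀ h0] at this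
      linarith
    have e5 : C * h ^ α * h < ε * h := mul_lt_mul_of_pos_right h2 h0
    have e6 : h * a = h * (D + 3 * ε) := by rw [hε]; ring
    have : h * deriv (u (x k)) t < h * a := by nlinarith
    exact lt_of_mul_lt_mul_left this h0.le

theorem abs_iSup_sub_iSup_le [Nonempty ι] {s s' K : ℝ}
    (hs : BddAbove (range fun x => u x s)) (hs' : BddAbove (range fun x => u x s'))
    (h : ∀ x, |u x s - u x s'| ≤ K) : |(⨆ x, u x s) - ⨆ x, u x s'| ≤ K := by
  rw [abs_sub_le_iff]
  constructor
  · rw [sub_le_iff_le_add]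
    exact ciSup_le fun x => by linarith [le_of_abs_le (h x), le_ciSup hs' x]
  · rw [sub_le_iff_le_add]
    exact ciSup_le fun x => by linarith [neg_le_of_abs_le (h x), le_ciSup hs x]

end FamilySup

/-- A function whose backward increments satisfy `S t - S s ≤ (t - s) (F (S t) + C (t - s)^α)`
stays below the solution of `φ' = F(φ)` with larger initial value. -/
theorem le_of_increment_le_ode {S φ F : ℝ → ℝ} {b C α : ℝ} (hα : 0 < α) (hb : 0 ≤ b)
    (hF : LocallyLipschitz F) (hS : ContinuousOn S (Icc 0 b))
    (hinc : ∀ s t, 0 ≤ s → s < t → t ≤ b →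
      S t - S s ≤ (t - s) * (F (S t) + C * (t - s) ^ α))
    (hφ : ContinuousOn φ (Icc 0 b))
    (hφ' : ∀ t ∈ Ico 0 b, HasDerivWithinAt φ (F (φ t)) (Ioi t) t)
    (h0 : S 0 ≤ φ 0) : S b ≤ φ b := by
  -- Both curves have compact range on [0, b], so one Lipschitz constant of F serves throughout.
  obtain ⟨L, hL⟩ := hF.locallyLipschitzOn (s := (S '' Icc 0 b) ∪ (φ '' Icc 0 b))
    |>.exists_lipschitzOnWith_of_compact
      ((isCompact_Icc.image_of_continuousOn hS).union (isCompact_Icc.image_of_continuousOn hφ))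
  have key := le_gronwallBound_of_liminf_deriv_right_le (f := fun t => max (S t - φ t) 0)
    (f' := fun t => L * max (S t - φ t) 0) (δ := 0) (K := L) (ε := 0) (a := 0) (b := b)
    ((hS.sub hφ).sup continuousOn_const) ?_ (by simpa using h0) (fun t _ => by simp)
    b (right_mem_Icc.mpr hb)
  · rw [gronwallBound_ε0_δ0] at key
    linarith [le_max_left (S b - φ b) 0]
  intro s hs r hr
  refine Eventually.frequently ?_
  have hsI : s ∈ Icc 0 b := Ico_subset_Icc_self hs
  have hIoc : Ioc s b ∈ 𝓝[>] s := Ioc_mem_nhdsGT hs.2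
  have hle : 𝓝[>] s ≤ 𝓝[Icc 0 b] s := by
    rw [← nhdsWithin_Ioc_eq_nhdsGT hs.2]
    exact nhdsWithin_mono s fun z hz => ⟨hs.1.trans hz.1.le, hz.2⟩
  have hSs : Tendsto S (𝓝[>] s) (𝓝 (S s)) := (hS s hsI).mono_left hle
  have hφs : Tendsto φ (𝓝[>] s) (𝓝 (φ s)) := (hφ s hsI).mono_left hle
  have hr0 : 0 < r := lt_of_le_of_lt (mul_nonneg L.2 (le_max_right _ _)) hr
  -- The increment bound from s to z carries F at the later value S z; continuity brings it back to
  -- F (S s) as z ↓ s.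
  have hslope : ∀ q, F (S s) - F (φ s) < q →
      ∀ᶠ z in 𝓝[>] s, (S z - φ z) - (S s - φ s) < q * (z - s) := by
    intro q hq
    have hsub : Tendsto (fun z => z - s) (𝓝[>] s) (𝓝[>] 0) := by
      refine tendsto_nhdsWithin_iff.mpr ⟨?_, ?_⟩
      · simpa using ((continuous_sub_right s).tendsto s).mono_left nhdsWithin_le_nhds
      · filter_upwards [self_mem_nhdsWithin] with z hz using sub_pos.mpr (mem_Ioi.mp hz)
    have hφd : Tendsto (slope φ s) (𝓝[>] s) (𝓝 (F (φ s))) := by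
      simpa using hasDerivWithinAt_iff_tendsto_slope.mp (hφ' s hs)
    have hlim : Tendsto (fun z => F (S z) + C * (z - s) ^ α - slope φ s z) (𝓝[>] s)
        (𝓝 (F (S s) + 0 - F (φ s))) :=
      (((hF.continuous.tendsto _).comp hSs).add
        ((tendsto_mul_rpow_nhdsGT_zero hα).comp hsub)).sub hφd
    rw [add_zero] at hlim
    filter_upwards [hlim.eventually (gt_mem_nhds hq), hIoc,
      self_mem_nhdsWithin] with z hz hzb hzs
    have hzs : 0 < z - s := sub_pos.mpr hzs
    have h1 := hinc s z hs.1 hzb.1 hzb.2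
    have h2 : φ z - φ s = (z - s) * slope φ s z := by
      rw [slope_def_field]; field_simp
    nlinarith
  rcases lt_or_ge (S s - φ s) 0 with hneg | hpos
  · have : Tendsto (fun z => S z - φ z) (𝓝[>] s) (𝓝 (S s - φ s)) := hSs.sub hφs
    filter_upwards [this.eventually (gt_mem_nhds hneg)] with z hz
    simpa [max_eq_right hz.le, max_eq_right hneg.le] using hr0
  · have hLip : F (S s) - F (φ s) ≤ L * (S s - φ s) := by
      have := hL.dist_le_mul (S s) (Or.inl ⟨s, hsI, rfl⟩) (φ s) (Or.inr ⟨s, hsI, rfl⟩)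
      rw [Real.dist_eq, Real.dist_eq, abs_of_nonneg hpos] at this
      exact (le_abs_self _).trans this
    have hr' : L * max (S s - φ s) 0 < r := hr
    rw [max_eq_left hpos] at hr'
    filter_upwards [hslope r (hLip.trans_lt hr'), self_mem_nhdsWithin] with z hz hzs
    have hzs : 0 < z - s := sub_pos.mpr hzs
    rw [max_eq_left hpos, inv_mul_lt_iff₀ hzs, sub_lt_iff_lt_add, max_lt_iff]
    constructor
    · linarith
    -- The value 0 of the positive part also obeys the bound since r > 0; this covers S s = φ s.
    · nlinarith [mul_pos hzs hr0]

/-! ### The time intervals, and regularity of functions on them. -/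

section TimeInterval

variable {T : EReal}

theorem exists_gt_mem_timeIoo {s : ℝ} (hs : s ∈ timeIco T) : ∃ b ∈ timeIoo T, s < b := by
  obtain ⟨b, hsb, hb⟩ := EReal.lt_iff_exists_real_btwn.mp hs.2
  have hsb : s < b := EReal.coe_lt_coe_iff.mp hsb
  exact ⟨b, ⟨hs.1.trans_lt hsb, hb⟩, hsb⟩

theorem timeIoo_subset_timeIco : timeIoo T ⊆ timeIco T := fun _ h => ⟨h.1.le, h.2⟩

theorem mem_timeIco_of_le {s b : ℝ} (hb : (b : EReal) < T) (h0 : 0 ≤ s) (hsb : s ≤ b) :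
    s ∈ timeIco T :=
  ⟨h0, (EReal.coe_le_coe_iff.mpr hsb).trans_lt hb⟩

theorem Icc_subset_timeIco {b : ℝ} (hb : (b : EReal) < T) : Icc 0 b ⊆ timeIco T :=
  fun _ hs => mem_timeIco_of_le hb hs.1 hs.2

theorem isOpen_timeIoo : IsOpen (timeIoo T) :=
  isOpen_Ioi.inter (isOpen_Iio.preimage continuous_coe_real_ereal)

theorem measurableSet_timeIco : MeasurableSet (timeIco T) :=
  measurableSet_Ici.inter (isOpen_Iio.preimage continuous_coe_real_ereal).measurableSet

theorem timeIco_mem_nhds {t : ℝ} (ht : t ∈ timeIoo T) : timeIco T ∈ 𝓝 t :=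
  mem_of_superset (isOpen_timeIoo.mem_nhds ht) timeIoo_subset_timeIco

/-- A function on `[0, T)` that is Lipschitz on every `[0, b]` is locally Lipschitz. -/
theorem locallyLipschitzOn_timeIco {f : ℝ → ℝ}
    (h : ∀ b ∈ timeIoo T, ∃ K, LipschitzOnWith K f (Icc 0 b)) :
    LocallyLipschitzOn (timeIco T) f := by
  intro s hs
  obtain ⟨b, hb, hsb⟩ := exists_gt_mem_timeIoo hs
  obtain ⟨K, hK⟩ := h b hb
  refine ⟨K, timeIco T ∩ Iio b, inter_mem_nhdsWithin _ (Iio_mem_nhds hsb), ?_⟩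
  exact hK.mono fun r hr => ⟨hr.1.1, hr.2.le⟩

/-- A function on `[0, T)` that is Lipschitz on every `[0, b]` is differentiable almost
everywhere. -/
theorem ae_differentiableAt_timeIco {f : ℝ → ℝ}
    (h : ∀ b ∈ timeIoo T, ∃ K, LipschitzOnWith K f (Icc 0 b)) :
    ∀ᵐ t ∂(volume.restrict (timeIco T)), DifferentiableAt ℝ f t := by
  have hbv : LocallyBoundedVariationOn f (timeIco T) := by
    intro a b ha hb
    obtain ⟨c, hc, hbc⟩ := exists_gt_mem_timeIoo hb
    obtain ⟨K, hK⟩ := h c hc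
    have hb0 : b ∈ Icc 0 c := ⟨hb.1, hbc.le⟩
    have := hK.locallyBoundedVariationOn 0 b (left_mem_Icc.mpr hc.1.le) hb0
    refine ne_top_of_le_ne_top this (eVariationOn.mono f ?_)
    exact fun r hr => ⟨⟨hr.1.1, hr.2.2.trans hbc.le⟩, hr.1.1, hr.2.2⟩
  -- Discarding the null set {0} upgrades differentiability within [0, T) to two-sided
  -- differentiability.
  have hne : ∀ᵐ t ∂(volume.restrict (timeIco T)), t ≠ 0 :=
    ae_restrict_of_ae (Measure.ae_ne volume 0)
  filter_upwards [hbv.ae_differentiableWithinAt measurableSet_timeIco, hne,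
    ae_restrict_mem measurableSet_timeIco] with t ht ht0 htT
  exact ht.differentiableAt (timeIco_mem_nhds ⟨htT.1.lt_of_ne' ht0, htT.2⟩)

end TimeInterval

/-! ### Slices of the solution, and the elliptic inequality from Omori–Yau. -/

namespace RiemCoord

variable {n : ℕ} {M : Type*} [TopologicalSpace M]
  [ChartedSpace (EuclideanSpace ℝ (Fin n)) M]

section SpaceTime

variable {T : EReal} {u : M → ℝ → ℝ}

theorem contMDiff_space_slice
    (hu : ContMDiffOn ((𝓡 n).prod 𝓘(ℝ, ℝ)) 𝓘(ℝ, ℝ) ∞ (fun p : M × ℝ => u p.1 p.2)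
      (univ ×ˢ timeIco T)) {t : ℝ} (ht : t ∈ timeIco T) :
    ContMDiff (𝓡 n) 𝓘(ℝ, ℝ) ∞ fun x => u x t :=
  contMDiffOn_univ.mp <| hu.comp (t := univ ×ˢ timeIco T) (f := fun x : M => (x, t))
    (contMDiff_id.prodMk contMDiff_const).contMDiffOn fun _ _ => ⟨mem_univ _, ht⟩

theorem contDiffOn_time_slice
    (hu : ContMDiffOn ((𝓡 n).prod 𝓘(ℝ, ℝ)) 𝓘(ℝ, ℝ) ∞ (fun p : M × ℝ => u p.1 p.2)
      (univ ×ˢ timeIco T)) (x : M) : ContDiffOn ℝ ∞ (u x) (timeIco T) :=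
  contMDiffOn_iff_contDiffOn.mp <| hu.comp (t := univ ×ˢ timeIco T) (f := fun t : ℝ => (x, t))
    (contMDiff_const.prodMk contMDiff_id).contMDiffOn fun _ ht => ⟨mem_univ _, ht⟩

end SpaceTime

variable [IsManifold (𝓡 n) ∞ M]

/-- Under the Omori–Yau maximum principle, an elliptic operator applied to a function bounded above
is asymptotically nonpositive along some maximizing sequence. -/
theorem OmoriYau.exists_seq_elliptic_le {g : SmoothMetric n M} (hOY : OmoriYau g) {f : M → ℝ}
    (hf : ContMDiff (𝓡 n) 𝓘(ℝ, ℝ) 2 f) (hbdd : BddAbove (range f))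
    {A : (x : M) → TangentSpace (𝓡 n) x →L[ℝ] TangentSpace (𝓡 n) x →L[ℝ] ℝ}
    (hAsymm : ∀ x v w, A x v w = A x w v) (hApos : ∀ x v, v ≠ 0 → 0 < A x v v)
    {C₀ : ℝ} (hAbd : ∀ x, tensorNorm g x (comp x (A x)) ≤ C₀)
    {V : (x : M) → TangentSpace (𝓡 n) x} {C₁ : ℝ} (hV : ∀ x, vecNorm g x (V x) ≤ C₁) :
    ∃ x : ℕ → M, ∀ k : ℕ, (⨆ y, f y) - 1 / ((k : ℝ) + 1) < f (x k) ∧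
      contract g (x k) (comp (x k) (A (x k))) (hess g f (x k))
          + g.inner (x k) (V (x k)) (grad g f (x k))
        ≤ 1 / ((k : ℝ) + 1) * (√n * C₀ + C₁) := by
  obtain ⟨x, hx⟩ := hOY f hf hbdd
  refine ⟨x, fun k => ⟨(hx k).1, ?_⟩⟩
  obtain ⟨-, hgr, hhess⟩ := hx k
  have hk : (0 : ℝ) ≤ 1 / ((k : ℝ) + 1) := by positivity
  have h1 := contract_le_of_quadForm_le g (x k) hk
    (comp_posSemidef (x k) (A (x k)) (hAsymm _) (hApos _)) (B := hess g f (x k)) fun v => by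
      rcases eq_or_ne v 0 with rfl | hv
      · simp
      · exact (hhess v hv).le
  have h2 : 1 / ((k : ℝ) + 1) * (√n * tensorNorm g (x k) (comp (x k) (A (x k))))
      ≤ 1 / ((k : ℝ) + 1) * (√n * C₀) :=
    mul_le_mul_of_nonneg_left (mul_le_mul_of_nonneg_left (hAbd _) (Real.sqrt_nonneg _)) hk
  have h3 := inner_le_vecNorm_mul_vecNorm g (x k) (V (x k)) (grad g f (x k))
  have h4 : vecNorm g (x k) (V (x k)) * vecNorm g (x k) (grad g f (x k))
      ≤ C₁ * (1 / ((k : ℝ) + 1)) :=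
    mul_le_mul (hV _) hgr.le (Real.sqrt_nonneg _) ((Real.sqrt_nonneg _).trans (hV (x k)))
  linarith

end RiemCoord
-- The maximum principle.
theorem theorem2 {n : ℕ} {M : Type*} [TopologicalSpace M]
    [T2Space M] [SecondCountableTopology M]
    [ChartedSpace (EuclideanSpace ℝ (Fin n)) M] [IsManifold (𝓡 n) ∞ M]
    (T : EReal)
    -- the metrics
    (g : ℝ → SmoothMetric n M)
    (hg : RiemCoord.SmoothFamily T g)
    (hOY : ∀ t ∈ timeIco T, RiemCoord.OmoriYau (g t))
    -- the solution and its bounds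
    (u : M → ℝ → ℝ)
    (hu : ContMDiffOn ((𝓡 n).prod 𝓘(ℝ, ℝ)) 𝓘(ℝ, ℝ) ∞ (fun p : M × ℝ => u p.1 p.2)
      (univ ×ˢ timeIco T))
    (C : ℝ → ℝ) (α : ℝ) (hα0 : 0 < α) (hα1 : α ≤ 1)
    (hubd : ∀ t ∈ timeIoo T, ∀ x, |u x t| ≤ C t)
    (hgrad : ∀ t ∈ timeIoo T, ∀ x,
      RiemCoord.vecNorm (g t) x (RiemCoord.grad (g t) (fun y => u y t) x) ≤ C t)
    (hutbd : ∀ t ∈ timeIoo T, ∀ x, ∀ s ∈ Ioc 0 t, |deriv (u x) s| ≤ C t)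
    (hutHolder : ∀ t ∈ timeIoo T, ∀ x, ∀ s ∈ Ioc 0 t, ∀ s' ∈ Ioc 0 t,
      |deriv (u x) s - deriv (u x) s'| ≤ C t * |s - s'| ^ α)
    -- the coefficients
    (H : (x : M) → ℝ → (TangentSpace (𝓡 n) x →L[ℝ] TangentSpace (𝓡 n) x →L[ℝ] ℝ))
    (hHsymm : ∀ t ∈ timeIoo T, ∀ x, ∀ v w : TangentSpace (𝓡 n) x, H x t v w = H x t w v)
    (hHpos : ∀ t ∈ timeIoo T, ∀ x, ∀ v : TangentSpace (𝓡 n) x, v ≠ 0 → 0 < H x t v v)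
    (C₀ : ℝ)
    (hHbd : ∀ t ∈ timeIoo T, ∀ x,
      RiemCoord.tensorNorm (g t) x (RiemCoord.comp x (H x t)) ≤ C₀)
    (X : (x : M) → ℝ → TangentSpace (𝓡 n) x → ℝ → TangentSpace (𝓡 n) x)
    (C₁ : ℝ → ℝ)
    (hXbd : ∀ t ∈ timeIoo T, ∀ x,
      RiemCoord.vecNorm (g t) x
        (X x (u x t) (RiemCoord.grad (g t) (fun y => u y t) x) t) ≤ C₁ t)
    (F : ℝ → ℝ) (hF : LocallyLipschitz F)
    -- the evolution equation
    (heq : ∀ t ∈ timeIoo T, ∀ x,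
      deriv (u x) t
          - RiemCoord.contract (g t) x (RiemCoord.comp x (H x t))
              (RiemCoord.hess (g t) (fun y => u y t) x)
        = (g t).inner x (X x (u x t) (RiemCoord.grad (g t) (fun y => u y t) x) t)
              (RiemCoord.grad (g t) (fun y => u y t) x)
          + F (u x t)) :
    -- the supremum is finite, locally Lipschitz, and differentiable almost everywhere
    (∀ t ∈ timeIco T, IsLUB (range fun x => u x t) (RiemCoord.supSpace u t)) ∧
    LocallyLipschitzOn (timeIco T) (RiemCoord.supSpace u) ∧
    (∀ᵐ t ∂(volume.restrict (timeIco T)), DifferentiableAt ℝ (RiemCoord.supSpace u) t) ∧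
    -- its derivative is the limit of `u_t` along any maximizing sequence
    (∀ t ∈ timeIoo T, DifferentiableAt ℝ (RiemCoord.supSpace u) t →
      ∀ x : ℕ → M, Tendsto (fun k => u (x k) t) atTop (𝓝 (RiemCoord.supSpace u t)) →
        Tendsto (fun k => deriv (u (x k)) t) atTop (𝓝 (deriv (RiemCoord.supSpace u) t))) ∧
    -- comparison with the ODE
    (∀ (T' : EReal) (φ : ℝ → ℝ),
      (∀ t ∈ timeIco T', HasDerivWithinAt φ (F (φ t)) (timeIco T') t) →
      φ 0 = RiemCoord.supSpace u 0 →
      ∀ x, ∀ t ∈ timeIco (min T T'), u x t ≤ φ t) := by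
  have hcont : ∀ x, ContinuousOn (u x) (timeIco T) := fun x =>
    (RiemCoord.contDiffOn_time_slice hu x).continuousOn
  have hdiff : ∀ x, ∀ s ∈ timeIoo T, DifferentiableAt ℝ (u x) s := fun x s hs =>
    ((RiemCoord.contDiffOn_time_slice hu x).contDiffAt (timeIco_mem_nhds hs)).differentiableAt
      (by simp)
  have hIoc : ∀ {b : ℝ}, b ∈ timeIoo T → ∀ r ∈ Ioc 0 b, r ∈ timeIoo T := fun hb r hr =>
    ⟨hr.1, (mem_timeIco_of_le hb.2 hr.1.le hr.2).2⟩
  have hlipx : ∀ b ∈ timeIoo T, ∀ x, ∀ s ∈ Icc 0 b, ∀ s' ∈ Icc 0 b,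
      |u x s - u x s'| ≤ C b * |s - s'| := by
    intro b hb x
    have aux : ∀ s ∈ Icc 0 b, ∀ s' ∈ Icc 0 b, s ≤ s' → |u x s' - u x s| ≤ C b * (s' - s) :=
      fun s hs s' hs' hle => abs_sub_le_of_abs_deriv_le hle
        ((hcont x).mono ((Icc_subset_Icc hs.1 hs'.2).trans (Icc_subset_timeIco hb.2)))
        (fun r hr => hdiff x r (hIoc hb r ⟨hs.1.trans_lt hr.1, hr.2.le.trans hs'.2⟩))
        (fun r hr => hutbd b hb x r ⟨hs.1.trans_lt hr.1, hr.2.le.trans hs'.2⟩)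
    intro s hs s' hs'
    rcases le_total s s' with hle | hle
    · rw [abs_sub_comm, abs_sub_comm s, abs_of_nonneg (sub_nonneg.mpr hle)]
      exact aux s hs s' hs' hle
    · rw [abs_of_nonneg (sub_nonneg.mpr hle)]
      exact aux s' hs' s hs hle
  -- Omori–Yau provides points even for f = 0, which excludes the empty manifold, where a real
  -- supremum would default to 0.
  have hne : ∀ t ∈ timeIco T, Nonempty M := fun t ht => by
    by_contra hM
    rw [not_nonempty_iff] at hM
    obtain ⟨x, -⟩ := hOY t ht (fun _ => 0) contMDiff_const
      (by rw [range_eq_empty]; exact bddAbove_empty)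
    exact hM.false (x 0)
  have hbdd : ∀ s ∈ timeIco T, BddAbove (range fun x => u x s) := by
    intro s hs
    obtain ⟨b, hb, hsb⟩ := exists_gt_mem_timeIoo hs
    -- The bound on u is assumed only at positive times; the Lipschitz estimate carries it from b
    -- back to s, including s = 0.
    refine ⟨C b + C b * |s - b|, ?_⟩
    rintro _ ⟨x, rfl⟩
    have h1 := le_of_abs_le (hlipx b hb x s ⟨hs.1, hsb.le⟩ b ⟨hb.1.le, le_rfl⟩)
    have h2 := le_of_abs_le (hubd b hb x)
    simp only
    linarith
  have hC : ∀ b ∈ timeIoo T, 0 ≤ C b := fun b hb => by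
    obtain ⟨x⟩ := hne b (timeIoo_subset_timeIco hb)
    exact (abs_nonneg _).trans (hubd b hb x)
  have hsuplip : ∀ b ∈ timeIoo T, ∃ K, LipschitzOnWith K (RiemCoord.supSpace u) (Icc 0 b) := by
    intro b hb
    have := hne b (timeIoo_subset_timeIco hb)
    refine ⟨(C b).toNNReal, LipschitzOnWith.of_dist_le_mul fun s hs s' hs' => ?_⟩
    rw [Real.coe_toNNReal _ (hC b hb), Real.dist_eq, Real.dist_eq]
    exact abs_iSup_sub_iSup_le (hbdd s (Icc_subset_timeIco hb.2 hs))
      (hbdd s' (Icc_subset_timeIco hb.2 hs')) fun x => hlipx b hb x s hs s' hs'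
  have htaylor : ∀ b ∈ timeIoo T, ∀ s ∈ Ioc 0 b, ∀ x, ∀ s' ∈ Icc 0 b,
      |u x s' - u x s - (s' - s) * deriv (u x) s| ≤ C b * |s' - s| ^ α * |s' - s| :=
    fun b hb s hs x s' hs' => abs_sub_sub_mul_deriv_le (hC b hb) hα0
      ((hcont x).mono (Icc_subset_timeIco hb.2)) (fun r hr => hdiff x r (hIoc hb r hr))
      (hutHolder b hb x) hs hs'
  have hinc : ∀ b ∈ timeIoo T, ∀ s t, 0 ≤ s → s < t → t ≤ b →
      RiemCoord.supSpace u t - RiemCoord.supSpace u s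
        ≤ (t - s) * (F (RiemCoord.supSpace u t) + C b * (t - s) ^ α) := by
    intro b hb s t hs hst htb
    have htI : t ∈ timeIoo T := hIoc hb t ⟨hs.trans_lt hst, htb⟩
    have htI' := timeIoo_subset_timeIco htI
    obtain ⟨x, hx⟩ := (hOY t htI').exists_seq_elliptic_le
      ((RiemCoord.contMDiff_space_slice hu htI').of_le ENat.LEInfty.out) (hbdd t htI')
      (A := fun x => H x t) (hHsymm t htI) (hHpos t htI) (hHbd t htI)
      (V := fun x => X x (u x t) (RiemCoord.grad (g t) (fun y => u y t) x) t) (hXbd t htI)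
    have hinv : Tendsto (fun k : ℕ => 1 / ((k : ℝ) + 1)) atTop (𝓝 0) :=
      tendsto_one_div_add_atTop_nhds_zero_nat
    have hux : Tendsto (fun k => u (x k) t) atTop (𝓝 (RiemCoord.supSpace u t)) := by
      refine tendsto_of_tendsto_of_tendsto_of_le_of_le ?_ tendsto_const_nhds (fun k => (hx k).1.le)
        fun k => le_ciSup (hbdd t htI') (x k)
      have h := hinv.const_sub (RiemCoord.supSpace u t)
      rwa [sub_zero] at h
    have hlim : Tendsto (fun k : ℕ => (t - s) * (1 / ((k : ℝ) + 1) * (√n * C₀ + C₁ t)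
        + F (u (x k) t) + C b * (t - s) ^ α) + 1 / ((k : ℝ) + 1)) atTop
        (𝓝 ((t - s) * (0 * (√n * C₀ + C₁ t)
          + F (RiemCoord.supSpace u t) + C b * (t - s) ^ α) + 0)) :=
      ((((hinv.mul_const _).add ((hF.continuous.tendsto _).comp hux)).add_const _).const_mul
        _).add hinv
    rw [zero_mul, zero_add, add_zero] at hlim
    -- Here s and t are fixed while k → ∞, so no control of `C₁ t` in t is needed.
    refine ge_of_tendsto' hlim fun k => ?_
    obtain ⟨h1, h2⟩ := hx k
    have h3 := heq t htI (x k)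
    have hst' : 0 < t - s := sub_pos.mpr hst
    have h4 := (abs_le.mp (htaylor b hb t ⟨hs.trans_lt hst, htb⟩ (x k) s
      ⟨hs, hst.le.trans htb⟩)).1
    rw [abs_sub_comm, abs_of_pos hst'] at h4
    have h5 : u (x k) s ≤ RiemCoord.supSpace u s :=
      le_ciSup (hbdd s (Icc_subset_timeIco hb.2 ⟨hs, hst.le.trans htb⟩)) (x k)
    have h6 : deriv (u (x k)) t
        ≤ 1 / ((k : ℝ) + 1) * (√n * C₀ + C₁ t) + F (u (x k) t) := by linarith
    have h7 := mul_le_mul_of_nonneg_left h6 hst'.le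
    have h8 : RiemCoord.supSpace u t - 1 / ((k : ℝ) + 1) < u (x k) t := h1
    linarith
  refine ⟨fun t ht => ?_, locallyLipschitzOn_timeIco hsuplip,
    ae_differentiableAt_timeIco hsuplip, fun t ht hd x hx => ?_, fun T' φ hφ hφ0 x t ht => ?_⟩
  · have := hne t ht
    exact isLUB_ciSup (hbdd t ht)
  · obtain ⟨b, hb, htb⟩ := exists_gt_mem_timeIoo (timeIoo_subset_timeIco ht)
    exact tendsto_deriv_of_tendsto_iSup hα0 ⟨ht.1, htb⟩
      (fun s hs => hbdd s (Icc_subset_timeIco hb.2 hs)) (htaylor b hb t ⟨ht.1, htb.le⟩)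
      hd.hasDerivAt x hx
  · have htT : t ∈ timeIco T := ⟨ht.1, ht.2.trans_le (min_le_left _ _)⟩
    have htT' : (t : EReal) < T' := ht.2.trans_le (min_le_right _ _)
    refine (le_ciSup (hbdd t htT) x).trans ?_
    -- Time 0 is separate because the constants `C t` give bounds only for t > 0.
    rcases ht.1.eq_or_lt with rfl | ht0
    · exact hφ0.ge
    have htI : t ∈ timeIoo T := ⟨ht0, htT.2⟩
    obtain ⟨K, hK⟩ := hsuplip t htI
    refine le_of_increment_le_ode hα0 ht.1 hF hK.continuousOn (hinc t htI)
      (fun s hs => (hφ s (Icc_subset_timeIco htT' hs)).continuousWithinAt.mono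
        (Icc_subset_timeIco htT')) (fun s hs => ?_) hφ0.ge
    -- Only the right derivative is needed, and points just after s stay in [0, T').
    refine (hφ s (Icc_subset_timeIco htT' (Ico_subset_Icc_self hs))).mono_of_mem_nhdsWithin ?_
    exact mem_of_superset (Ioc_mem_nhdsGT hs.2) fun r hr =>
      mem_timeIco_of_le htT' (hs.1.trans hr.1.le) hr.2
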